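/- Let $n\in\{2,3,4\}$, $\alpha=\sqrt n-1$, $\lambda\ge 0$, $c_0>0$, $c_1\in\mathbb R$ and $c_2=\frac{(n-1)(\alpha-1)}{2}$. Let $h\in C^2((0,\infty))$ satisfy $$2r^2h(r)h_{rr}(r)=(n-1)h(r)(h(r)-1)+rh_r(r)\bigl(rh_r(r)-\lambda r-(n-1)\bigr),\qquad h(r)>0,\qquad\text{for all } r>0,$$ and $\lim_{r\to0^+}r^{\alpha}h(r)=c_0$, and suppose that for some $\varepsilon>0$ the function $w(r)=r^\alpha h(r)$ satisfies, for all $0<r<\varepsilon$, $$w_r(r)=-c_2r^{\alpha-1}+c_1r^{\alpha}+\frac{\alpha\lambda}{2}r^{\alpha}\log r+r^{\alpha}\left\{\frac{n-1}{2}\int_r^{\varepsilon}\frac{\rho^{-1}w_r(\rho)}{w(\rho)}\,d\rho-\frac{\lambda}{2}\int_0^r\frac{w_r(\rho)}{w(\rho)}\,d\rho-\frac12\int_r^{\varepsilon}\frac{\rho^{-\alpha}w_r(\rho)^2}{w(\rho)}\,d\rho\right\}.$$ Then there is a constant $0<\delta_0<1$ such that for all $0<r\le\delta_0$, where each $o(1)$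 is a function of $r$ that tends to $0$ as $r\to0^+$: if $n=2$ or $n=3$, $$h(r)=\frac1{r^{\alpha}}\left(c_0-\frac{c_2}{\alpha}r^{\alpha}-\frac{c_2(c_2+n-1)}{4c_0\alpha(1-\alpha)}r^{2\alpha}+o(1)r^{2\alpha}\right),\qquad h_r(r)=\frac1{r^{\alpha+1}}\left(-\alpha c_0-\frac{c_2(c_2+n-1)}{4c_0(1-\alpha)}r^{2\alpha}+o(1)r^{2\alpha}\right);$$ if $n=4$, $$h(r)=\frac1r\left(c_0+\frac{\lambda}{4}r^2\log r+o(1)r^2|\log r|\right),\qquad h_r(r)=\frac1{r^2}\left(-c_0+\frac{\lambda}{4}r^2\log r+o(1)r^2|\log r|\right).$$ -/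

import Mathlib

open Set Filter Topology

namespace SolitonODE

/-- The blow-up exponent `α = √n - 1`. -/
noncomputable def alpha (n : ℕ) : ℝ := Real.sqrt (n : ℝ) - 1

/-- The constant `c₂ = (n - 1) (α - 1) / 2 = (n - 1) (√n - 2) / 2`. -/
noncomputable def c2 (n : ℕ) : ℝ := ((n : ℝ) - 1) * (alpha n - 1) / 2

/-- The function `w(r) = r ^ α * h(r)`. -/
noncomputable def w (n : ℕ) (h : ℝ → ℝ) (r : ℝ) : ℝ := r ^ alpha n * h r

/-- `h > 0` and
`2 r² h h_rr = (n - 1) h (h - 1) + r h_r (r h_r - lam r - (n - 1))` on `(0, ∞)`. -/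
def SolvesODE (n : ℕ) (lam : ℝ) (h : ℝ → ℝ) : Prop :=
  ∀ r : ℝ, 0 < r → 0 < h r ∧
    2 * r ^ 2 * h r * deriv (deriv h) r
      = ((n : ℝ) - 1) * h r * (h r - 1)
        + r * deriv h r * (r * deriv h r - lam * r - ((n : ℝ) - 1))

/-- The integral equation for `w = r ^ α * h` on `(0, ε)`, with parameter `c₁`:
`w_r = -c₂ r^(α-1) + c₁ r^α + (α lam / 2) r^α log r
  + r^α { (n-1)/2 ∫_r^ε ρ⁻¹ w_r / w - lam/2 ∫_0^r w_r / w - 1/2 ∫_r^ε ρ^(-α) w_r² / w }`. -/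
def SolvesIntegralEq (n : ℕ) (lam c₁ ε : ℝ) (h : ℝ → ℝ) : Prop :=
  ∀ r : ℝ, 0 < r → r < ε →
    deriv (w n h) r
      = -c2 n * r ^ (alpha n - 1) + c₁ * r ^ alpha n
        + alpha n * lam / 2 * r ^ alpha n * Real.log r
        + r ^ alpha n *
          (((n : ℝ) - 1) / 2 * (∫ ρ in r..ε, ρ⁻¹ * deriv (w n h) ρ / w n h ρ)
            - lam / 2 * (∫ ρ in (0 : ℝ)..r, deriv (w n h) ρ / w n h ρ)
            - 1 / 2 * (∫ ρ in r..ε, ρ ^ (-alpha n) * deriv (w n h) ρ ^ 2 / w n h ρ))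

/-- `h` is a global singular solution with parameters `c₀`, `c₁`: it is `C²` and positive on
`(0, ∞)`, solves the differential equation there, satisfies `r ^ α * h(r) → c₀` as `r → 0⁺`,
and satisfies the integral equation with parameter `c₁` on `(0, ε)` for some `ε > 0`. -/
structure IsGlobalSingularSolution (n : ℕ) (lam c₀ c₁ : ℝ) (h : ℝ → ℝ) : Prop where
  contDiffOn : ContDiffOn ℝ 2 h (Ioi 0)
  ode : SolvesODE n lam h
  blowup : Tendsto (fun r : ℝ => r ^ alpha n * h r) (𝓝[>] 0) (𝓝 c₀)
  integralEq : ∃ ε : ℝ, 0 < ε ∧ SolvesIntegralEq n lam c₁ ε h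

end SolitonODE

/-! Write `v = r ^ (-α) * w'`. The integral equation expresses `v` as `-κ / r`, a constant, a
logarithm, and the integrals `A = logInt`, `Q = quadInt` and one that tends to `0`, with `κ = c₂`.
The main step is `r * v → -κ`. Integration by parts gives `r * A → 0`, so `r * (v + Q / 2) → -κ`. It
remains to show `r * Q → 0`, although `Q` is quadratic in `w'`. This is a bootstrap resting on the
convergence of `w`: `r ^ α * (r * Q) → 0`, then a logarithmic bound on `r * Q`, then the limit
itself (`tendsto_rpow_mul_quadInt`, `exists_mul_quadInt_le`, `tendsto_mul_quadInt`). Once `r * v →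
-κ`, l'Hôpital's rule gives the growth of `A` and `Q`, hence the next term of `v`, and one more
application gives that of `w`. For `n = 2, 3` one has `0 < α < 1` and the scale is `r ^ (α - 1)`;
for `n = 4`, `α = 1` and `κ = 0`, and the scale is `-log r`. -/

namespace SolitonODE

open Asymptotics

/-! ### L'Hôpital rules and elementary limits at `0⁺`. -/

/-- An `∞/∞` form of l'Hôpital's rule at `0⁺`, for little-o. -/
theorem isLittleO_of_deriv {f f' g g' : ℝ → ℝ} {δ : ℝ} (hδ : 0 < δ)
    (hf : ∀ r ∈ Ioo 0 δ, HasDerivAt f (f' r) r) (hg : ∀ r ∈ Ioo 0 δ, HasDerivAt g (g' r) r)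
    (hg' : ∀ r ∈ Ioo 0 δ, g' r ≤ 0) (htop : Tendsto g (𝓝[>] 0) atTop)
    (h : f' =o[𝓝[>] 0] g') : f =o[𝓝[>] 0] g := by
  rw [isLittleO_iff]
  intro η hη
  have h1 := (isLittleO_iff.1 h) (half_pos hη)
  obtain ⟨u, hu, hu'⟩ := (mem_nhdsGT_iff_exists_Ioo_subset).1 h1
  have hu0 : 0 < u := hu
  set m := min u δ with hm
  have hm0 : 0 < m := lt_min hu0 hδ
  set s := m / 2 with hs
  have hs0 : 0 < s := half_pos hm0
  have hsm : s < m := half_lt_self hm0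
  have hsub : ∀ r ∈ Ioc 0 s, r ∈ Ioo 0 δ ∧ r ∈ Ioo 0 u := fun r hr =>
    ⟨⟨hr.1, (hr.2.trans_lt hsm).trans_le (min_le_right _ _)⟩,
      ⟨hr.1, (hr.2.trans_lt hsm).trans_le (min_le_left _ _)⟩⟩
  have hbd : ∀ r ∈ Ioc 0 s, |f' r| ≤ -(η / 2 * g' r) := by
    intro r hr
    have : |f' r| ≤ η / 2 * |g' r| := hu' (hsub r hr).2
    rw [abs_of_nonpos (hg' r (hsub r hr).1)] at this
    linarith
  -- Taking `σ = ±1` bounds `|f r|` by `η / 2 * g r` plus a constant fixed at `s`; since `g → ∞`,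
  -- the other half of `η` absorbs that constant. No limit of `f` is needed.
  have key : ∀ σ : ℝ, |σ| = 1 → AntitoneOn (fun r => σ * f r + η / 2 * g r) (Ioc 0 s) := by
    intro σ hσ
    have hd : ∀ r ∈ Ioc 0 s,
        HasDerivAt (fun r => σ * f r + η / 2 * g r) (σ * f' r + η / 2 * g' r) r := fun r hr =>
      ((hf r (hsub r hr).1).const_mul σ).add ((hg r (hsub r hr).1).const_mul (η / 2))
    refine antitoneOn_of_deriv_nonpos (convex_Ioc 0 s)
      (fun r hr => (hd r hr).continuousAt.continuousWithinAt)
      (fun r hr => (hd r (interior_subset hr)).differentiableAt.differentiableWithinAt) ?_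
    intro r hr
    rw [(hd r (interior_subset hr)).deriv]
    have h3 := hbd r (interior_subset hr)
    have h4 : σ * f' r ≤ |f' r| := by
      calc σ * f' r ≤ |σ * f' r| := le_abs_self _
        _ = |f' r| := by rw [abs_mul, hσ, one_mul]
    linarith
  have hev : ∀ᶠ r in 𝓝[>] (0 : ℝ), r ∈ Ioc 0 s := Ioc_mem_nhdsGT hs0
  filter_upwards [hev, htop.eventually_ge_atTop 0,
    htop.eventually_ge_atTop (2 / η * (|f s| - η / 2 * g s))] with r hr h0 hbig
  have hss : s ∈ Ioc 0 s := ⟨hs0, le_rfl⟩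
  have k1 := key 1 (by simp) hr hss hr.2
  have k2 := key (-1) (by simp) hr hss hr.2
  simp only at k1 k2
  have hbig' : |f s| - η / 2 * g s ≤ η / 2 * g r := by
    have := mul_le_mul_of_nonneg_left hbig (half_pos hη).le
    have e : η / 2 * (2 / η * (|f s| - η / 2 * g s)) = |f s| - η / 2 * g s := by
      field_simp
    linarith
  rw [Real.norm_eq_abs, Real.norm_eq_abs, abs_of_nonneg h0, abs_le]
  have := le_abs_self (f s)
  have := neg_abs_le (f s)
  constructor <;> linarith

/-- An `∞/∞` form of l'Hôpital's rule at `0⁺`. -/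
theorem tendsto_div_of_deriv {f f' g g' : ℝ → ℝ} {δ L : ℝ} (hδ : 0 < δ)
    (hf : ∀ r ∈ Ioo 0 δ, HasDerivAt f (f' r) r) (hg : ∀ r ∈ Ioo 0 δ, HasDerivAt g (g' r) r)
    (hg' : ∀ r ∈ Ioo 0 δ, g' r < 0) (htop : Tendsto g (𝓝[>] 0) atTop)
    (h : Tendsto (fun r => f' r / g' r) (𝓝[>] 0) (𝓝 L)) :
    Tendsto (fun r => f r / g r) (𝓝[>] 0) (𝓝 L) := by
  have hev : ∀ᶠ r in 𝓝[>] (0 : ℝ), r ∈ Ioo 0 δ := Ioo_mem_nhdsGT hδ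
  have h1 : (fun r => f' r - L * g' r) =o[𝓝[>] 0] g' := by
    rw [isLittleO_iff_tendsto' (hev.mono fun r hr h0 => absurd h0 (hg' r hr).ne)]
    have h2 : Tendsto (fun r => f' r / g' r - L) (𝓝[>] 0) (𝓝 0) := by
      simpa using h.sub_const L
    refine h2.congr' ?_
    filter_upwards [hev] with r hr
    have := (hg' r hr).ne
    field_simp
  have h2 := isLittleO_of_deriv (f := fun r => f r - L * g r) hδ
    (fun r hr => (hf r hr).sub ((hg r hr).const_mul L)) hg (fun r hr => (hg' r hr).le) htop h1
  have h3 := h2.tendsto_div_nhds_zero.add_const L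
  rw [zero_add] at h3
  refine h3.congr' ?_
  filter_upwards [htop.eventually_gt_atTop 0] with r hr
  field_simp
  ring

theorem tendsto_rpow_mul_log {a : ℝ} (ha : 0 < a) :
    Tendsto (fun r : ℝ => r ^ a * Real.log r) (𝓝[>] 0) (𝓝 0) := by
  simpa only [mul_comm] using tendsto_log_mul_rpow_nhdsGT_zero ha

theorem tendsto_rpow_zero {a : ℝ} (ha : 0 < a) :
    Tendsto (fun r : ℝ => r ^ a) (𝓝[>] 0) (𝓝 0) := by
  have := (Real.continuousAt_rpow_const 0 a (Or.inr ha.le)).tendsto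
  rw [Real.zero_rpow ha.ne'] at this
  exact this.mono_left nhdsWithin_le_nhds

theorem tendsto_rpow_neg_atTop {a : ℝ} (ha : a < 0) :
    Tendsto (fun r : ℝ => r ^ a) (𝓝[>] 0) atTop := tendsto_rpow_neg_nhdsGT_zero ha

/-- The derivative of an integral with respect to its lower limit. -/
theorem hasDerivAt_integral_left {φ : ℝ → ℝ} (hφ : ContinuousOn φ (Ioi 0)) {ε r : ℝ}
    (hr : 0 < r) (hε : 0 < ε) :
    HasDerivAt (fun r => ∫ ρ in r..ε, φ ρ) (-φ r) r := by
  refine intervalIntegral.integral_hasDerivAt_left ?_ ?_ ?_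
  · exact (hφ.mono fun x hx => lt_of_lt_of_le (lt_min hr hε) hx.1).intervalIntegrable
  · exact hφ.stronglyMeasurableAtFilter isOpen_Ioi r hr
  · exact hφ.continuousAt (Ioi_mem_nhds hr)

/-- The integral of a logarithmic derivative over `(0, r)` tends to `0`, even where it is not
absolutely convergent (and hence `0` by convention). -/
theorem tendsto_integral_logDeriv {w w' : ℝ → ℝ} {c : ℝ} (hc : 0 < c)
    (hw : ∀ r, 0 < r → HasDerivAt w (w' r) r) (hpos : ∀ r, 0 < r → 0 < w r)
    (hlim : Tendsto w (𝓝[>] 0) (𝓝 c)) :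
    Tendsto (fun r => ∫ ρ in (0 : ℝ)..r, w' ρ / w ρ) (𝓝[>] 0) (𝓝 0) := by
  have hlog : Tendsto (fun r => Real.log (w r)) (𝓝[>] 0) (𝓝 (Real.log c)) :=
    (Real.continuousAt_log hc.ne').tendsto.comp hlim
  have h0 : Tendsto (fun r => Real.log (w r) - Real.log c) (𝓝[>] 0) (𝓝 0) := by
    simpa using hlog.sub_const (Real.log c)
  rw [tendsto_zero_iff_norm_tendsto_zero] at h0 ⊢
  refine squeeze_zero' (Eventually.of_forall fun _ => norm_nonneg _) ?_ h0
  filter_upwards [self_mem_nhdsWithin] with r hr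
  have hr : 0 < r := hr
  by_cases hi : IntervalIntegrable (fun ρ => w' ρ / w ρ) MeasureTheory.volume 0 r
  · have hd : ∀ x, 0 < x → HasDerivAt (fun r => Real.log (w r)) (w' x / w x) x := fun x hx =>
      (hw x hx).log (hpos x hx).ne'
    rw [intervalIntegral.integral_eq_sub_of_hasDerivAt_of_tendsto hr (fun x hx => hd x hx.1) hi
      hlog ((hd r hr).continuousAt.tendsto.mono_left nhdsWithin_le_nhds)]
  · rw [intervalIntegral.integral_undef hi]
    simp

end SolitonODE

/-! ### The bootstrap: leading behaviour of the rescaled derivative. -/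

namespace SolitonODE

/-- A positive `C¹` function `w` with `w → c₀` at `0⁺` which satisfies the integral equation with
general constants. -/
structure IsSingularProfile (α N lam c₀ c₁ κ ε : ℝ) (w w' : ℝ → ℝ) : Prop where
  alpha_pos : 0 < α
  c₀_pos : 0 < c₀
  ε_pos : 0 < ε
  hasDerivAt : ∀ r, 0 < r → HasDerivAt w (w' r) r
  continuousOn : ContinuousOn w' (Ioi 0)
  pos : ∀ r, 0 < r → 0 < w r
  tendsto : Tendsto w (𝓝[>] 0) (𝓝 c₀)
  eq : ∀ r, 0 < r → r < ε → w' r = -κ * r ^ (α - 1) + c₁ * r ^ α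
    + α * lam / 2 * r ^ α * Real.log r
    + r ^ α * (N / 2 * (∫ ρ in r..ε, ρ⁻¹ * w' ρ / w ρ)
      - lam / 2 * (∫ ρ in (0 : ℝ)..r, w' ρ / w ρ)
      - 1 / 2 * (∫ ρ in r..ε, ρ ^ (-α) * w' ρ ^ 2 / w ρ))

/-- The weighted logarithmic integral in the integral equation. -/
noncomputable def logInt (ε : ℝ) (w w' : ℝ → ℝ) (r : ℝ) : ℝ := ∫ ρ in r..ε, ρ⁻¹ * w' ρ / w ρ

/-- The quadratic integral in the integral equation. -/
noncomputable def quadInt (α ε : ℝ) (w w' : ℝ → ℝ) (r : ℝ) : ℝ :=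
  ∫ ρ in r..ε, ρ ^ (-α) * w' ρ ^ 2 / w ρ

/-- The rescaled derivative `r ^ (-α) * w'`. -/
noncomputable def rescaledDeriv (α : ℝ) (w' : ℝ → ℝ) (r : ℝ) : ℝ := w' r / r ^ α

theorem tendsto_nhdsGT_zero_id : Tendsto (fun r : ℝ => r) (𝓝[>] 0) (𝓝 0) :=
  tendsto_id.mono_left nhdsWithin_le_nhds

theorem hasDerivAt_inv_Ioo {r : ℝ} (hr : 0 < r) :
    HasDerivAt (fun r : ℝ => r⁻¹) (-(r ^ 2)⁻¹) r := by
  simpa using hasDerivAt_inv hr.ne'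

namespace IsSingularProfile

variable {α N lam c₀ c₁ κ ε : ℝ} {w w' : ℝ → ℝ}

theorem deriv_eq (r : ℝ) (hr : 0 < r) : w' r = r ^ α * rescaledDeriv α w' r := by
  have := (Real.rpow_pos_of_pos hr α).ne'
  unfold rescaledDeriv
  field_simp

theorem rescaledDeriv_eq (H : IsSingularProfile α N lam c₀ c₁ κ ε w w') {r : ℝ} (hr : 0 < r)
    (hrε : r < ε) : rescaledDeriv α w' r = -κ / r + c₁ + α * lam / 2 * Real.log r
      + N / 2 * logInt ε w w' r - lam / 2 * (∫ ρ in (0 : ℝ)..r, w' ρ / w ρ)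
      - 1 / 2 * quadInt α ε w w' r := by
  have hx := (Real.rpow_pos_of_pos hr α).ne'
  rw [rescaledDeriv, H.eq r hr hrε, Real.rpow_sub hr, Real.rpow_one, logInt, quadInt]
  field_simp
  ring

theorem hasDerivAt_logInt (H : IsSingularProfile α N lam c₀ c₁ κ ε w w') {r : ℝ} (hr : 0 < r) :
    HasDerivAt (logInt ε w w') (-(r⁻¹ * w' r / w r)) r := by
  refine hasDerivAt_integral_left (φ := fun ρ => ρ⁻¹ * w' ρ / w ρ) ?_ hr H.ε_pos
  refine ((continuousOn_inv₀.mono fun x hx => ?_).mul H.continuousOn).div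
    (fun x hx => (H.hasDerivAt x hx).continuousAt.continuousWithinAt) fun x hx => (H.pos x hx).ne'
  exact (show (0 : ℝ) < x from hx).ne'

theorem continuousOn_quad (H : IsSingularProfile α N lam c₀ c₁ κ ε w w') :
    ContinuousOn (fun ρ => ρ ^ (-α) * w' ρ ^ 2 / w ρ) (Ioi 0) := by
  refine ((ContinuousOn.rpow_const continuousOn_id fun x hx => Or.inl ?_).mul
    (H.continuousOn.pow 2)).div
    (fun x hx => (H.hasDerivAt x hx).continuousAt.continuousWithinAt) fun x hx => (H.pos x hx).ne'
  exact (show (0 : ℝ) < x from hx).ne'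

theorem hasDerivAt_quadInt (H : IsSingularProfile α N lam c₀ c₁ κ ε w w') {r : ℝ} (hr : 0 < r) :
    HasDerivAt (quadInt α ε w w') (-(r ^ (-α) * w' r ^ 2 / w r)) r :=
  hasDerivAt_integral_left H.continuousOn_quad hr H.ε_pos

theorem quad_nonneg (H : IsSingularProfile α N lam c₀ c₁ κ ε w w') {r : ℝ} (hr : 0 < r) :
    0 ≤ r ^ (-α) * w' r ^ 2 / w r := by
  have := H.pos r hr
  have := Real.rpow_pos_of_pos hr (-α)
  positivity

theorem quadInt_nonneg (H : IsSingularProfile α N lam c₀ c₁ κ ε w w') {r : ℝ} (hr : 0 < r)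
    (hrε : r ≤ ε) : 0 ≤ quadInt α ε w w' r :=
  intervalIntegral.integral_nonneg hrε fun _ hx => H.quad_nonneg (hr.trans_le hx.1)

theorem antitoneOn_quadInt (H : IsSingularProfile α N lam c₀ c₁ κ ε w w') :
    AntitoneOn (quadInt α ε w w') (Ioi 0) := by
  refine antitoneOn_of_deriv_nonpos (convex_Ioi 0)
    (fun r hr => (H.hasDerivAt_quadInt hr).continuousAt.continuousWithinAt)
    (fun r hr => (H.hasDerivAt_quadInt
      (interior_subset hr)).differentiableAt.differentiableWithinAt) ?_
  intro r hr
  have hr : 0 < r := interior_subset hr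
  rw [(H.hasDerivAt_quadInt hr).deriv]
  linarith [H.quad_nonneg hr]

theorem tendsto_mul_logInt (H : IsSingularProfile α N lam c₀ c₁ κ ε w w') :
    Tendsto (fun r => r * logInt ε w w' r) (𝓝[>] 0) (𝓝 0) := by
  have hlog : Tendsto (fun r => Real.log (w r) - Real.log c₀) (𝓝[>] 0) (𝓝 0) := by
    simpa using ((Real.continuousAt_log H.c₀_pos.ne').tendsto.comp H.tendsto).sub_const
      (Real.log c₀)
  -- Integration by parts removes `w'`: what is left is `log w - log c₀ → 0` times the derivative of
  -- `r⁻¹`, so the sum is `o(r⁻¹)`.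
  have hd : ∀ r ∈ Ioo 0 ε, HasDerivAt
      (fun r => logInt ε w w' r + r⁻¹ * (Real.log (w r) - Real.log c₀))
      (-(r ^ 2)⁻¹ * (Real.log (w r) - Real.log c₀)) r := by
    intro r hr
    have := (H.hasDerivAt_logInt hr.1).add ((hasDerivAt_inv_Ioo hr.1).mul
      (((H.hasDerivAt r hr.1).log (H.pos r hr.1).ne').sub_const (Real.log c₀)))
    refine this.congr_deriv ?_
    ring
  have := tendsto_div_of_deriv H.ε_pos hd (fun r hr => hasDerivAt_inv_Ioo hr.1)
    (fun r hr => by have := hr.1; simp; positivity) tendsto_inv_nhdsGT_zero (L := 0) (by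
      refine hlog.congr' ?_
      filter_upwards [self_mem_nhdsWithin] with r hr
      have : r ≠ 0 := (show (0 : ℝ) < r from hr).ne'
      field_simp)
  have h2 := this.sub hlog
  rw [sub_zero] at h2
  refine h2.congr' ?_
  filter_upwards [self_mem_nhdsWithin] with r hr
  have : r ≠ 0 := (show (0 : ℝ) < r from hr).ne'
  field_simp
  ring

theorem tendsto_integral (H : IsSingularProfile α N lam c₀ c₁ κ ε w w') :
    Tendsto (fun r => ∫ ρ in (0 : ℝ)..r, w' ρ / w ρ) (𝓝[>] 0) (𝓝 0) :=
  tendsto_integral_logDeriv H.c₀_pos H.hasDerivAt H.pos H.tendsto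

theorem eventually_mem (H : IsSingularProfile α N lam c₀ c₁ κ ε w w') :
    ∀ᶠ r in 𝓝[>] (0 : ℝ), r ∈ Ioo 0 ε := Ioo_mem_nhdsGT H.ε_pos

theorem tendsto_mul_rescaledDeriv_add (H : IsSingularProfile α N lam c₀ c₁ κ ε w w') :
    Tendsto (fun r => r * (rescaledDeriv α w' r + 1 / 2 * quadInt α ε w w' r))
      (𝓝[>] 0) (𝓝 (-κ)) := by
  have h1 := (tendsto_nhdsGT_zero_id.mul_const c₁)
  have h2 := (tendsto_rpow_mul_log one_pos).const_mul (α * lam / 2)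
  have h3 := H.tendsto_mul_logInt.const_mul (N / 2)
  have h4 := (tendsto_nhdsGT_zero_id.mul H.tendsto_integral).const_mul (lam / 2)
  have h5 := (((h1.add h2).add h3).sub h4).const_add (-κ)
  simp only [zero_mul, mul_zero, add_zero, sub_zero, Real.rpow_one] at h5
  refine h5.congr' ?_
  filter_upwards [H.eventually_mem] with r hr
  rw [H.rescaledDeriv_eq hr.1 hr.2]
  have := hr.1.ne'
  field_simp
  ring

/-- Since `w` converges, its increments over `[r/2, r]` tend to `0`, so by the mean value theorem
`w'` is `o(1 / r)` at some `ξ` there. The bound on `r * (v + Q / 2)` at `ξ` then controls `Q ξ`, and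
monotonicity carries this to `Q r ≤ Q ξ`. -/
theorem tendsto_rpow_mul_quadInt (H : IsSingularProfile α N lam c₀ c₁ κ ε w w') :
    Tendsto (fun r => r ^ α * (r * quadInt α ε w w' r)) (𝓝[>] 0) (𝓝 0) := by
  obtain ⟨M, hM⟩ :=
    (H.tendsto_mul_rescaledDeriv_add.norm.isBoundedUnder_le)
  rw [eventually_map] at hM
  obtain ⟨u, hu, hu'⟩ := (mem_nhdsGT_iff_exists_Ioo_subset).1 hM
  have hu0 : 0 < u := hu
  have hhalf : Tendsto (fun r : ℝ => r / 2) (𝓝[>] 0) (𝓝[>] 0) := by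
    refine tendsto_nhdsWithin_iff.2 ⟨by simpa using tendsto_nhdsGT_zero_id.div_const 2, ?_⟩
    filter_upwards [self_mem_nhdsWithin] with r hr
    exact half_pos (show (0 : ℝ) < r from hr)
  have hΔ : Tendsto (fun r => |w r - w (r / 2)|) (𝓝[>] 0) (𝓝 0) := by
    simpa using (H.tendsto.sub (H.tendsto.comp hhalf)).abs
  have hb := ((tendsto_rpow_zero H.alpha_pos).const_mul (4 * M)).add
    (hΔ.const_mul (4 * (2 : ℝ) ^ α))
  simp only [mul_zero, add_zero] at hb
  refine squeeze_zero' ?_ ?_ hb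
  · filter_upwards [H.eventually_mem] with r hr
    have := H.quadInt_nonneg hr.1 hr.2.le
    have := hr.1
    positivity
  · filter_upwards [H.eventually_mem, Ioo_mem_nhdsGT hu0] with r hr hru
    have hr0 := hr.1
    obtain ⟨ξ, hξ, hslope⟩ := exists_hasDerivAt_eq_slope w w' (half_lt_self hr0)
      (fun x hx => (H.hasDerivAt x
        ((half_pos hr0).trans_le hx.1)).continuousAt.continuousWithinAt)
      (fun x hx => H.hasDerivAt x ((half_pos hr0).trans hx.1))
    have hξ0 : 0 < ξ := (half_pos hr0).trans hξ.1
    have hG : |ξ * (rescaledDeriv α w' ξ + 1 / 2 * quadInt α ε w w' ξ)| ≤ M :=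
      hu' ⟨hξ0, hξ.2.trans hru.2⟩
    have hanti := H.antitoneOn_quadInt (show ξ ∈ Ioi 0 from hξ0) (show r ∈ Ioi 0 from hr0) hξ.2.le
    have hQ := H.quadInt_nonneg hr0 hr.2.le
    set x := r ^ α with hx
    set y := ξ ^ α with hy
    have hx0 : 0 < x := Real.rpow_pos_of_pos hr0 α
    have hy0 : 0 < y := Real.rpow_pos_of_pos hξ0 α
    -- The factor `2 ^ α` comes from `r < 2 * ξ`.
    have hxy : x ≤ 2 ^ α * y := by
      rw [hx, hy, ← Real.mul_rpow two_pos.le hξ0.le]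
      exact Real.rpow_le_rpow hr0.le (by linarith [hξ.1]) H.alpha_pos.le
    have hslope' : y * rescaledDeriv α w' ξ * r = 2 * (w r - w (r / 2)) := by
      rw [← deriv_eq ξ hξ0, hslope]
      field_simp
      ring
    have hv : y * |rescaledDeriv α w' ξ| * r = 2 * |w r - w (r / 2)| := by
      simpa only [abs_mul, abs_of_pos hy0, abs_of_pos hr0, abs_two] using congrArg abs hslope'
    have hG2 : ξ * (1 / 2 * quadInt α ε w w' r) ≤ M + ξ * |rescaledDeriv α w' ξ| := by
      have h1 := (le_abs_self _).trans hG
      have h2 : ξ * (-rescaledDeriv α w' ξ) ≤ ξ * |rescaledDeriv α w' ξ| :=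
        mul_le_mul_of_nonneg_left (neg_le_abs _) hξ0.le
      have h3 := mul_le_mul_of_nonneg_left hanti hξ0.le
      linarith
    have h4 : r * quadInt α ε w w' r ≤ 4 * M + 2 * (r * |rescaledDeriv α w' ξ|) := by
      have h5 : r / 2 * (1 / 2 * quadInt α ε w w' r) ≤ ξ * (1 / 2 * quadInt α ε w w' r) :=
        mul_le_mul_of_nonneg_right hξ.1.le (by positivity)
      have h6 : ξ * |rescaledDeriv α w' ξ| ≤ r * |rescaledDeriv α w' ξ| :=
        mul_le_mul_of_nonneg_right hξ.2.le (abs_nonneg _)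
      have h7 : 1 / 2 * quadInt α ε w w' r ≤ M / ξ + |rescaledDeriv α w' ξ| := by
        rw [div_add' _ _ _ hξ0.ne', le_div_iff₀ hξ0]
        linarith
      have h8 : M / ξ ≤ 2 * M / r := by
        have hM0 : 0 ≤ M := (abs_nonneg _).trans hG
        rw [div_le_div_iff₀ hξ0 hr0]
        nlinarith [hξ.1]
      have h9 : 1 / 2 * quadInt α ε w w' r * r ≤ (2 * M / r + |rescaledDeriv α w' ξ|) * r :=
        mul_le_mul_of_nonneg_right (h7.trans (by linarith)) hr0.le
      have h10 : (2 * M / r + |rescaledDeriv α w' ξ|) * r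
          = 2 * M + r * |rescaledDeriv α w' ξ| := by field_simp
      linarith
    calc x * (r * quadInt α ε w w' r)
        ≤ x * (4 * M + 2 * (r * |rescaledDeriv α w' ξ|)) := mul_le_mul_of_nonneg_left h4 hx0.le
      _ = 4 * M * x + x * (2 * (r * |rescaledDeriv α w' ξ|)) := by ring
      _ ≤ 4 * M * x + (2 ^ α * y) * (2 * (r * |rescaledDeriv α w' ξ|)) := by gcongr
      _ = 4 * M * x + 2 * 2 ^ α * (y * |rescaledDeriv α w' ξ| * r) := by ring
      _ = 4 * M * x + 4 * 2 ^ α * |w r - w (r / 2)| := by rw [hv]; ring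

theorem tendsto_mul_deriv (H : IsSingularProfile α N lam c₀ c₁ κ ε w w') :
    Tendsto (fun r => r * w' r) (𝓝[>] 0) (𝓝 0) := by
  have h := ((tendsto_rpow_zero H.alpha_pos).mul H.tendsto_mul_rescaledDeriv_add).sub
    (H.tendsto_rpow_mul_quadInt.const_mul (1 / 2))
  simp only [zero_mul, mul_zero, sub_zero] at h
  refine h.congr' ?_
  filter_upwards [self_mem_nhdsWithin] with r hr
  rw [deriv_eq (α := α) (w' := w') r hr]
  ring

/-- With `|r * (v + Q / 2)| ≤ M` and `|r * w' / w| < 1`, the derivative of `r * Q + M * log r` is at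
least `Q - |v| + M / r ≥ Q / 2 ≥ 0`, so this function stays below its value at a fixed point. -/
theorem exists_mul_quadInt_le (H : IsSingularProfile α N lam c₀ c₁ κ ε w w') :
    ∃ C M : ℝ, ∀ᶠ r in 𝓝[>] (0 : ℝ), r * quadInt α ε w w' r ≤ C - M * Real.log r := by
  obtain ⟨M, hM⟩ := H.tendsto_mul_rescaledDeriv_add.norm.isBoundedUnder_le
  rw [eventually_map] at hM
  have h1 : ∀ᶠ r in 𝓝[>] (0 : ℝ), |r * w' r / w r| < 1 := by
    have := (H.tendsto_mul_deriv.div H.tendsto H.c₀_pos.ne').abs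
    simp only [zero_div, abs_zero] at this
    exact this.eventually_lt_const one_pos
  obtain ⟨u, hu, hu'⟩ := (mem_nhdsGT_iff_exists_Ioo_subset).1 ((hM.and h1).and H.eventually_mem)
  have hu0 : 0 < u := hu
  have hd : ∀ r ∈ Ioo 0 u, HasDerivAt (fun r => r * quadInt α ε w w' r + M * Real.log r)
      (1 * quadInt α ε w w' r + r * -(r ^ (-α) * w' r ^ 2 / w r) + M * r⁻¹) r := fun r hr =>
    ((hasDerivAt_id r).mul (H.hasDerivAt_quadInt hr.1)).add
      ((Real.hasDerivAt_log hr.1.ne').const_mul M)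
  have hmono : MonotoneOn (fun r => r * quadInt α ε w w' r + M * Real.log r) (Ioo 0 u) := by
    refine monotoneOn_of_deriv_nonneg (convex_Ioo 0 u)
      (fun r hr => (hd r hr).continuousAt.continuousWithinAt)
      (fun r hr => (hd r (interior_subset hr)).differentiableAt.differentiableWithinAt) ?_
    intro r hr
    have hr : r ∈ Ioo 0 u := interior_subset hr
    rw [(hd r hr).deriv]
    have hr0 := hr.1
    obtain ⟨⟨hG, hs⟩, hε⟩ := hu' hr
    have hG : |r * (rescaledDeriv α w' r + 1 / 2 * quadInt α ε w w' r)| ≤ M := hG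
    have hQ := H.quadInt_nonneg hr0 hε.2.le
    have hx0 : 0 < r ^ α := Real.rpow_pos_of_pos hr0 α
    have hw := H.pos r hr0
    have e1 : r * -(r ^ (-α) * w' r ^ 2 / w r) = -(r * w' r / w r * rescaledDeriv α w' r) := by
      rw [rescaledDeriv, Real.rpow_neg hr0.le]
      field_simp
    have h2 : r * w' r / w r * rescaledDeriv α w' r ≤ |rescaledDeriv α w' r| := by
      refine (le_abs_self _).trans ?_
      rw [abs_mul]
      exact mul_le_of_le_one_left (abs_nonneg _) hs.le
    have h3 : |rescaledDeriv α w' r| ≤ M * r⁻¹ + 1 / 2 * quadInt α ε w w' r := by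
      have h4 : |rescaledDeriv α w' r + 1 / 2 * quadInt α ε w w' r| ≤ M * r⁻¹ := by
        rw [abs_mul, abs_of_pos hr0] at hG
        rw [← div_eq_mul_inv, le_div_iff₀ hr0]
        linarith
      have h5 := abs_sub_abs_le_abs_sub (rescaledDeriv α w' r) (-(1 / 2 * quadInt α ε w w' r))
      rw [abs_neg, abs_of_nonneg (by positivity : 0 ≤ 1 / 2 * quadInt α ε w w' r),
        sub_neg_eq_add] at h5
      linarith
    rw [e1]
    linarith
  refine ⟨u / 2 * quadInt α ε w w' (u / 2) + M * Real.log (u / 2), M, ?_⟩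
  filter_upwards [Ioo_mem_nhdsGT (half_pos hu0)] with r hr
  have := hmono ⟨hr.1, hr.2.trans (half_lt_self hu0)⟩ ⟨half_pos hu0, half_lt_self hu0⟩ hr.2.le
  simp only at this
  linarith

/-- The logarithmic bound makes `r ^ (α / 2) * (r * v)` tend to `0`. Its square divided by `w` is
exactly the ratio of the derivatives of `Q` and `r⁻¹`, because `Q' = -r ^ α * v ^ 2 / w`. -/
theorem tendsto_mul_quadInt (H : IsSingularProfile α N lam c₀ c₁ κ ε w w') :
    Tendsto (fun r => r * quadInt α ε w w' r) (𝓝[>] 0) (𝓝 0) := by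
  obtain ⟨C, M, hCM⟩ := H.exists_mul_quadInt_le
  have hα2 : 0 < α / 2 := half_pos H.alpha_pos
  have hx := tendsto_rpow_zero hα2
  have h1 : Tendsto (fun r => r ^ (α / 2) * (r * quadInt α ε w w' r)) (𝓝[>] 0) (𝓝 0) := by
    have hb := (hx.mul_const C).sub ((tendsto_rpow_mul_log hα2).const_mul M)
    simp only [zero_mul, mul_zero, sub_zero] at hb
    refine squeeze_zero' ?_ ?_ hb
    · filter_upwards [H.eventually_mem] with r hr
      have := H.quadInt_nonneg hr.1 hr.2.le
      have := hr.1
      positivity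
    · filter_upwards [hCM, self_mem_nhdsWithin] with r hr hr0
      have hr0 : 0 < r := hr0
      have := mul_le_mul_of_nonneg_left hr (Real.rpow_pos_of_pos hr0 (α / 2)).le
      linarith
  have h2 : Tendsto (fun r => r ^ (α / 2) * (r * rescaledDeriv α w' r)) (𝓝[>] 0) (𝓝 0) := by
    have := (hx.mul H.tendsto_mul_rescaledDeriv_add).sub (h1.const_mul (1 / 2))
    simp only [zero_mul, mul_zero, sub_zero] at this
    refine this.congr' (Eventually.of_forall fun r => ?_)
    ring
  have h3 := (h2.pow 2).div H.tendsto H.c₀_pos.ne'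
  rw [zero_pow two_ne_zero, zero_div] at h3
  have h4 := tendsto_div_of_deriv H.ε_pos (fun r hr => H.hasDerivAt_quadInt hr.1)
    (fun r hr => hasDerivAt_inv_Ioo hr.1)
    (fun r hr => by have := hr.1; simp; positivity) tendsto_inv_nhdsGT_zero (L := 0) (by
      refine h3.congr' ?_
      filter_upwards [self_mem_nhdsWithin] with r hr
      have hr0 : 0 < r := hr
      have hw := (H.pos r hr0).ne'
      have hx0 : 0 < r ^ (α / 2) := Real.rpow_pos_of_pos hr0 _
      have hxx : r ^ α = (r ^ (α / 2)) ^ 2 := by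
        rw [← Real.rpow_natCast, ← Real.rpow_mul hr0.le]
        congr 1
        push_cast
        ring
      simp only [Pi.div_apply, rescaledDeriv]
      rw [Real.rpow_neg hr0.le, hxx]
      field_simp)
  refine h4.congr' (Eventually.of_forall fun r => ?_)
  rw [div_inv_eq_mul, mul_comm]

theorem tendsto_mul_rescaledDeriv (H : IsSingularProfile α N lam c₀ c₁ κ ε w w') :
    Tendsto (fun r => r * rescaledDeriv α w' r) (𝓝[>] 0) (𝓝 (-κ)) := by
  have := H.tendsto_mul_rescaledDeriv_add.sub (H.tendsto_mul_quadInt.const_mul (1 / 2))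
  simp only [mul_zero, sub_zero] at this
  refine this.congr' (Eventually.of_forall fun r => ?_)
  ring

end IsSingularProfile
end SolitonODE

/-! ### Next-order terms of `w'` and `w`, then the passage from `h` to a profile. -/

namespace SolitonODE

namespace IsSingularProfile

variable {α N lam c₀ c₁ κ ε : ℝ} {w w' : ℝ → ℝ}

/-- The second-order term of `w'` when `α < 1`. -/
theorem tendsto_rescaledDeriv_remainder (H : IsSingularProfile α N lam c₀ c₁ κ ε w w')
    (hα : α < 1) :
    Tendsto (fun r => (rescaledDeriv α w' r + κ / r) / r ^ (α - 1)) (𝓝[>] 0)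
      (𝓝 (-(κ * (κ + N) / (2 * c₀ * (1 - α))))) := by
  have hβ : 0 < 1 - α := sub_pos.2 hα
  have hg : ∀ r ∈ Ioo 0 ε, HasDerivAt (fun r : ℝ => r ^ (α - 1)) ((α - 1) * r ^ (α - 1 - 1)) r :=
    fun r hr => Real.hasDerivAt_rpow_const (Or.inl hr.1.ne')
  have hg' : ∀ r ∈ Ioo 0 ε, (α - 1) * r ^ (α - 1 - 1) < 0 := fun r hr =>
    mul_neg_of_neg_of_pos (by linarith) (Real.rpow_pos_of_pos hr.1 _)
  have htop : Tendsto (fun r : ℝ => r ^ (α - 1)) (𝓝[>] 0) atTop :=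
    tendsto_rpow_neg_atTop (by linarith)
  -- The ratios of derivatives are `r * v / w / (1 - α)` for `A` and `(r * v) ^ 2 / w / (1 - α)` for
  -- `Q`; both limits follow from `r * v → -κ`.
  have hA := tendsto_div_of_deriv H.ε_pos (fun r hr => H.hasDerivAt_logInt hr.1) hg hg' htop
    (L := -κ / c₀ / (1 - α)) (by
      refine ((H.tendsto_mul_rescaledDeriv.div H.tendsto H.c₀_pos.ne').div_const _).congr' ?_
      filter_upwards [self_mem_nhdsWithin] with r hr
      have hr0 : 0 < r := hr
      have hw := (H.pos r hr0).ne'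
      have hx0 : 0 < r ^ α := Real.rpow_pos_of_pos hr0 _
      have hα1 : α - 1 ≠ 0 := by linarith
      simp only [Pi.div_apply, rescaledDeriv]
      rw [Real.rpow_sub hr0, Real.rpow_sub hr0, Real.rpow_one, ← neg_sub α 1]
      field_simp)
  have hF := tendsto_div_of_deriv H.ε_pos (fun r hr => H.hasDerivAt_quadInt hr.1) hg hg' htop
    (L := (-κ) ^ 2 / c₀ / (1 - α)) (by
      refine (((H.tendsto_mul_rescaledDeriv.pow 2).div H.tendsto
        H.c₀_pos.ne').div_const _).congr' ?_
      filter_upwards [self_mem_nhdsWithin] with r hr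
      have hr0 : 0 < r := hr
      have hw := (H.pos r hr0).ne'
      have hx0 : 0 < r ^ α := Real.rpow_pos_of_pos hr0 _
      have hα1 : α - 1 ≠ 0 := by linarith
      simp only [Pi.div_apply, rescaledDeriv]
      rw [Real.rpow_sub hr0, Real.rpow_sub hr0, Real.rpow_one, Real.rpow_neg hr0.le, ← neg_sub α 1]
      field_simp)
  have hx := tendsto_rpow_zero hβ
  -- As `r ^ (α - 1) → ∞` faster than `|log r|`, only `A` and `Q` contribute to the limit.
  have h := (((hx.mul_const c₁).add ((tendsto_rpow_mul_log hβ).const_mul (α * lam / 2))).add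
    (hA.const_mul (N / 2))).sub ((hx.mul H.tendsto_integral).const_mul (lam / 2)) |>.sub
    (hF.const_mul (1 / 2))
  have e : 0 * c₁ + α * lam / 2 * 0 + N / 2 * (-κ / c₀ / (1 - α)) - lam / 2 * (0 * 0)
      - 1 / 2 * ((-κ) ^ 2 / c₀ / (1 - α)) = -(κ * (κ + N) / (2 * c₀ * (1 - α))) := by
    have := H.c₀_pos.ne'
    have := hβ.ne'
    field_simp
    ring
  rw [e] at h
  refine h.congr' ?_
  filter_upwards [H.eventually_mem] with r hr
  have hr0 := hr.1
  have hx0 : 0 < r ^ α := Real.rpow_pos_of_pos hr0 _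
  rw [H.rescaledDeriv_eq hr0 hr.2, Real.rpow_sub hr0, Real.rpow_sub hr0, Real.rpow_one]
  field_simp
  ring

/-- The second-order term of `w` when `α < 1`. -/
theorem tendsto_remainder (H : IsSingularProfile α N lam c₀ c₁ κ ε w w') (hα : α < 1) :
    Tendsto (fun r => (w r - c₀ + κ / α * r ^ α) / r ^ (2 * α)) (𝓝[>] 0)
      (𝓝 (-(κ * (κ + N) / (4 * c₀ * α * (1 - α))))) := by
  have hα0 := H.alpha_pos
  have h2α : 0 < 2 * α := by linarith
  have hlim := (H.tendsto_rescaledDeriv_remainder hα).div_const (2 * α)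
  have e : -(κ * (κ + N) / (2 * c₀ * (1 - α))) / (2 * α)
      = -(κ * (κ + N) / (4 * c₀ * α * (1 - α))) := by
    have := H.c₀_pos.ne'
    have : 1 - α ≠ 0 := by linarith
    field_simp
    norm_num
  rw [e] at hlim
  refine HasDerivAt.lhopital_zero_nhdsGT (f' := fun r => w' r + κ / α * (α * r ^ (α - 1)))
    (g' := fun r => 2 * α * r ^ (2 * α - 1)) ?_ ?_ ?_ ?_ (tendsto_rpow_zero h2α) ?_
  · filter_upwards [self_mem_nhdsWithin] with r hr
    have hr0 : 0 < r := hr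
    exact ((H.hasDerivAt r hr0).sub_const c₀).add
      ((Real.hasDerivAt_rpow_const (Or.inl hr0.ne')).const_mul _)
  · filter_upwards [self_mem_nhdsWithin] with r hr
    exact Real.hasDerivAt_rpow_const (Or.inl (show (0 : ℝ) < r from hr).ne')
  · filter_upwards [self_mem_nhdsWithin] with r hr
    exact (mul_pos h2α (Real.rpow_pos_of_pos hr _)).ne'
  · simpa using (H.tendsto.sub_const c₀).add ((tendsto_rpow_zero hα0).const_mul (κ / α))
  · refine hlim.congr' ?_
    filter_upwards [self_mem_nhdsWithin] with r hr
    have hr0 : 0 < r := hr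
    have hx0 : 0 < r ^ α := Real.rpow_pos_of_pos hr0 _
    rw [deriv_eq (α := α) (w' := w') r hr0, two_mul α, Real.rpow_sub hr0, Real.rpow_sub hr0,
      Real.rpow_add hr0, Real.rpow_one]
    field_simp

theorem tendsto_neg_log_atTop : Tendsto (fun r => -Real.log r) (𝓝[>] 0) atTop :=
  tendsto_neg_atBot_atTop.comp Real.tendsto_log_nhdsGT_zero

/-- The leading term of `w'` when `α = 1` and `κ = 0`. -/
theorem tendsto_rescaledDeriv_div_log (H : IsSingularProfile 1 N lam c₀ c₁ 0 ε w w') :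
    Tendsto (fun r => rescaledDeriv 1 w' r / -Real.log r) (𝓝[>] 0) (𝓝 (-(lam / 2))) := by
  have hg : ∀ r ∈ Ioo 0 ε, HasDerivAt (fun r : ℝ => -Real.log r) (-r⁻¹) r :=
    fun r hr => (Real.hasDerivAt_log hr.1.ne').neg
  have hg' : ∀ r ∈ Ioo 0 ε, -r⁻¹ < 0 := fun r hr => neg_neg_of_pos (inv_pos.2 hr.1)
  have hv := H.tendsto_mul_rescaledDeriv
  rw [neg_zero] at hv
  have hA := tendsto_div_of_deriv H.ε_pos (fun r hr => H.hasDerivAt_logInt hr.1) hg hg'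
    tendsto_neg_log_atTop (L := 0 / c₀) (by
      refine (hv.div H.tendsto H.c₀_pos.ne').congr' ?_
      filter_upwards [self_mem_nhdsWithin] with r hr
      have hr0 : 0 < r := hr
      have hw := (H.pos r hr0).ne'
      simp only [Pi.div_apply, rescaledDeriv, Real.rpow_one]
      field_simp)
  have hF := tendsto_div_of_deriv H.ε_pos (fun r hr => H.hasDerivAt_quadInt hr.1) hg hg'
    tendsto_neg_log_atTop (L := 0 ^ 2 / c₀) (by
      refine ((hv.pow 2).div H.tendsto H.c₀_pos.ne').congr' ?_
      filter_upwards [self_mem_nhdsWithin] with r hr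
      have hr0 : 0 < r := hr
      have hw := (H.pos r hr0).ne'
      simp only [Pi.div_apply, rescaledDeriv, Real.rpow_one, Real.rpow_neg hr0.le]
      field_simp)
  have hi := tendsto_neg_log_atTop.inv_tendsto_atTop
  -- Here `r * v → 0` makes `A` and `Q` negligible against `log r`, so only the explicit logarithm
  -- survives.
  have h := ((((hi.const_mul c₁).add_const (-(lam / 2))).add (hA.const_mul (N / 2))).sub
    ((H.tendsto_integral.mul hi).const_mul (lam / 2))).sub (hF.const_mul (1 / 2))
  have e : c₁ * 0 + -(lam / 2) + N / 2 * (0 / c₀) - lam / 2 * (0 * 0) - 1 / 2 * (0 ^ 2 / c₀)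
      = -(lam / 2) := by simp
  rw [e] at h
  refine h.congr' ?_
  filter_upwards [H.eventually_mem, tendsto_neg_log_atTop.eventually_gt_atTop 0] with r hr hl
  have hl' : Real.log r ≠ 0 := by linarith
  rw [H.rescaledDeriv_eq hr.1 hr.2]
  simp only [Pi.inv_apply]
  field_simp
  ring

/-- The leading correction of `w` when `α = 1` and `κ = 0`. -/
theorem tendsto_sub_div_log (H : IsSingularProfile 1 N lam c₀ c₁ 0 ε w w') :
    Tendsto (fun r => (w r - c₀) / (r ^ 2 * -Real.log r)) (𝓝[>] 0) (𝓝 (-(lam / 4))) := by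
  have hi := tendsto_neg_log_atTop.inv_tendsto_atTop
  have hbig : ∀ᶠ r in 𝓝[>] (0 : ℝ), 1 < -Real.log r := tendsto_neg_log_atTop.eventually_gt_atTop 1
  refine HasDerivAt.lhopital_zero_nhdsGT (f' := w')
    (g' := fun r => 2 * r * -Real.log r + r ^ 2 * -r⁻¹) ?_ ?_ ?_ ?_ ?_ ?_
  · filter_upwards [self_mem_nhdsWithin] with r hr
    exact (H.hasDerivAt r hr).sub_const c₀
  · filter_upwards [self_mem_nhdsWithin] with r hr
    have hr0 : 0 < r := hr
    exact ((hasDerivAt_pow 2 r).mul (Real.hasDerivAt_log hr0.ne').neg).congr_deriv (by simp)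
  · filter_upwards [self_mem_nhdsWithin, hbig] with r hr hl
    have hr0 : 0 < r := hr
    have e : 2 * r * -Real.log r + r ^ 2 * -r⁻¹ = r * (2 * -Real.log r - 1) := by
      field_simp
      ring
    rw [e]
    exact (mul_pos hr0 (by linarith)).ne'
  · simpa using H.tendsto.sub_const c₀
  · have := (tendsto_rpow_mul_log two_pos).neg
    rw [neg_zero] at this
    refine this.congr' ?_
    filter_upwards with r
    rw [Real.rpow_two]
    ring
  -- With `L = -log r`, the quotient of derivatives is `(v / L) / (2 - 1 / L)`.
  · have h := H.tendsto_rescaledDeriv_div_log.div (hi.const_sub 2) (by norm_num)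
    have e : -(lam / 2) / (2 - 0) = -(lam / 4) := by ring
    rw [e] at h
    refine h.congr' ?_
    filter_upwards [self_mem_nhdsWithin, hbig] with r hr hl
    have hr0 : 0 < r := hr
    have hl1 : Real.log r ≠ 0 := by linarith
    have hl2 : 2 * Real.log r + 1 ≠ 0 := by linarith
    have hl3 : 2 * r * -Real.log r + r ^ 2 * -r⁻¹ = -(r * (2 * Real.log r + 1)) := by
      field_simp
      ring
    simp only [Pi.div_apply, Pi.inv_apply]
    rw [deriv_eq (α := 1) (w' := w') r hr0, Real.rpow_one, hl3]
    have e2 : 2 - (-Real.log r)⁻¹ = (2 * Real.log r + 1) / Real.log r := by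
      field_simp
      ring
    rw [e2]
    field_simp

end IsSingularProfile

theorem alpha_bounds {n : ℕ} (hn : n = 2 ∨ n = 3) : 0 < alpha n ∧ alpha n < 1 := by
  have h1 : (1 : ℝ) < n := by rcases hn with rfl | rfl <;> norm_num
  have h4 : (n : ℝ) < 2 ^ 2 := by rcases hn with rfl | rfl <;> norm_num
  unfold alpha
  constructor
  · rw [sub_pos]
    exact Real.lt_sqrt_of_sq_lt (by linarith)
  · have := (Real.sqrt_lt' two_pos).2 h4
    linarith

theorem alpha_four : alpha 4 = 1 := by
  have : Real.sqrt 4 = 2 := by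
    rw [show (4 : ℝ) = 2 ^ 2 by norm_num]
    exact Real.sqrt_sq two_pos.le
  unfold alpha
  push_cast
  rw [this]
  norm_num

theorem c2_four : c2 4 = 0 := by
  simp [c2, alpha_four]

theorem hasDerivAt_of_contDiffOn {h : ℝ → ℝ} (hh : ContDiffOn ℝ 2 h (Ioi 0)) {r : ℝ}
    (hr : 0 < r) : HasDerivAt h (deriv h r) r :=
  ((hh.differentiableOn (by norm_num)).differentiableAt (Ioi_mem_nhds hr)).hasDerivAt

theorem hasDerivAt_w {n : ℕ} {h : ℝ → ℝ} (hh : ContDiffOn ℝ 2 h (Ioi 0)) {r : ℝ} (hr : 0 < r) :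
    HasDerivAt (w n h) (alpha n * r ^ (alpha n - 1) * h r + r ^ alpha n * deriv h r) r :=
  (Real.hasDerivAt_rpow_const (Or.inl hr.ne')).mul (hasDerivAt_of_contDiffOn hh hr)

theorem IsGlobalSingularSolution.isSingularProfile {n : ℕ} {lam c₀ c₁ : ℝ} {h : ℝ → ℝ}
    (hα : 0 < alpha n) (hc₀ : 0 < c₀) (hh : IsGlobalSingularSolution n lam c₀ c₁ h) :
    ∃ ε, IsSingularProfile (alpha n) ((n : ℝ) - 1) lam c₀ c₁ (c2 n) ε (w n h)
      (deriv (w n h)) := by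
  obtain ⟨ε, hε, heq⟩ := hh.integralEq
  refine ⟨ε, hα, hc₀, hε, fun r hr => ?_, ?_, fun r hr => ?_, hh.blowup, heq⟩
  · exact (hasDerivAt_w hh.contDiffOn hr).differentiableAt.hasDerivAt
  · have hx : ∀ a : ℝ, ContinuousOn (fun r : ℝ => r ^ a) (Ioi 0) := fun a =>
      ContinuousOn.rpow_const continuousOn_id fun x hx => Or.inl (show (0 : ℝ) < x from hx).ne'
    have hcont : ContinuousOn
        (fun r => alpha n * r ^ (alpha n - 1) * h r + r ^ alpha n * deriv h r) (Ioi 0) :=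
      ((continuousOn_const.mul (hx _)).mul hh.contDiffOn.continuousOn).add
        ((hx _).mul (hh.contDiffOn.continuousOn_deriv_of_isOpen isOpen_Ioi (by norm_num)))
    exact hcont.congr fun r hr => (hasDerivAt_w hh.contDiffOn hr).deriv
  · exact mul_pos (Real.rpow_pos_of_pos hr _) (hh.ode r hr).1

end SolitonODE

/-! ### Expansions of `h` and `h_r`. -/

namespace SolitonODE

theorem mul_deriv_w {n : ℕ} {h : ℝ → ℝ} (hh : ContDiffOn ℝ 2 h (Ioi 0)) {r : ℝ} (hr : 0 < r) :
    r ^ (alpha n + 1) * deriv h r = r * deriv (w n h) r - alpha n * w n h r := by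
  rw [(hasDerivAt_w hh hr).deriv, w, Real.rpow_add hr, Real.rpow_sub hr, Real.rpow_one]
  field_simp
  ring

theorem IsGlobalSingularSolution.expansion_two_three {n : ℕ} (hn : n = 2 ∨ n = 3)
    {lam c₀ c₁ : ℝ} (hc₀ : 0 < c₀) {h : ℝ → ℝ} (hh : IsGlobalSingularSolution n lam c₀ c₁ h) :
    ∃ e₁ e₂ : ℝ → ℝ, Tendsto e₁ (𝓝[>] 0) (𝓝 0) ∧ Tendsto e₂ (𝓝[>] 0) (𝓝 0) ∧
      ∀ r : ℝ, 0 < r →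
        h r = 1 / r ^ alpha n * (c₀ - c2 n / alpha n * r ^ alpha n
          - c2 n * (c2 n + (n : ℝ) - 1) / (4 * c₀ * alpha n * (1 - alpha n)) * r ^ (2 * alpha n)
          + e₁ r * r ^ (2 * alpha n)) ∧
        deriv h r = 1 / r ^ (alpha n + 1) * (-alpha n * c₀
          - c2 n * (c2 n + (n : ℝ) - 1) / (4 * c₀ * (1 - alpha n)) * r ^ (2 * alpha n)
          + e₂ r * r ^ (2 * alpha n)) := by
  obtain ⟨hα0, hα1⟩ := alpha_bounds hn
  obtain ⟨ε, H⟩ := hh.isSingularProfile hα0 hc₀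
  have hq₁ := H.tendsto_remainder hα1
  have hq₂ := H.tendsto_rescaledDeriv_remainder hα1
  set Z := c2 n * (c2 n + (n : ℝ) - 1) / (4 * c₀ * (1 - alpha n)) with hZ
  have hβ : 1 - alpha n ≠ 0 := by linarith
  have hZ₁ : c2 n * (c2 n + ((n : ℝ) - 1)) / (4 * c₀ * alpha n * (1 - alpha n))
      = Z / alpha n := by
    rw [hZ]
    field_simp
    ring
  have hZ₂ : c2 n * (c2 n + ((n : ℝ) - 1)) / (2 * c₀ * (1 - alpha n)) = 2 * Z := by
    rw [hZ]
    field_simp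
    ring
  have hZ₃ : c2 n * (c2 n + (n : ℝ) - 1) / (4 * c₀ * alpha n * (1 - alpha n)) = Z / alpha n := by
    rw [← hZ₁, add_sub_assoc]
  rw [hZ₁] at hq₁
  rw [hZ₂] at hq₂
  rw [hZ₃]
  set q₁ : ℝ → ℝ := fun r =>
    (w n h r - c₀ + c2 n / alpha n * r ^ alpha n) / r ^ (2 * alpha n) with hq₁d
  set q₂ : ℝ → ℝ := fun r =>
    (rescaledDeriv (alpha n) (deriv (w n h)) r + c2 n / r) / r ^ (alpha n - 1) with hq₂d
  -- The errors are the normalized remainders minus their limits. By `mul_deriv_w`, that of `h_r`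
  -- combines as `q₂ - α * q₁`, with limit `-2Z + Z = -Z`; the `r ^ α` terms cancel. Being exact
  -- quotients, they give identities for every `r > 0`.
  refine ⟨fun r => q₁ r + Z / alpha n, fun r => q₂ r - alpha n * q₁ r + Z, ?_, ?_, ?_⟩
  · simpa using hq₁.add_const (Z / alpha n)
  · have := (hq₂.sub (hq₁.const_mul (alpha n))).add_const Z
    have e : -(2 * Z) - alpha n * -(Z / alpha n) + Z = 0 := by
      field_simp
      ring
    rwa [e] at this
  · intro r hr
    have hx0 : 0 < r ^ alpha n := Real.rpow_pos_of_pos hr _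
    have hx2 : 0 < r ^ (2 * alpha n) := Real.rpow_pos_of_pos hr _
    have hw₁ : q₁ r * r ^ (2 * alpha n) = w n h r - c₀ + c2 n / alpha n * r ^ alpha n :=
      div_mul_cancel₀ _ hx2.ne'
    have hw₂ : q₂ r * r ^ (2 * alpha n) = r * deriv (w n h) r + c2 n * r ^ alpha n := by
      rw [hq₂d]
      simp only [rescaledDeriv]
      rw [Real.rpow_sub hr, Real.rpow_one, two_mul, Real.rpow_add hr]
      field_simp
    constructor
    · rw [one_div, eq_inv_mul_iff_mul_eq₀ hx0.ne']
      change w n h r = _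
      linear_combination -hw₁
    · rw [one_div, eq_inv_mul_iff_mul_eq₀ (Real.rpow_pos_of_pos hr _).ne',
        mul_deriv_w hh.contDiffOn hr]
      have : alpha n * (c2 n / alpha n) = c2 n := mul_div_cancel₀ _ hα0.ne'
      linear_combination alpha n * hw₁ - hw₂ + r ^ alpha n * this

/-- The restriction `r < 1` makes `|log r| = -log r` and keeps the denominators of `q₁` and `q₂`
nonzero. -/
theorem IsGlobalSingularSolution.expansion_four {lam c₀ c₁ : ℝ} (hc₀ : 0 < c₀) {h : ℝ → ℝ}
    (hh : IsGlobalSingularSolution 4 lam c₀ c₁ h) :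
    ∃ e₁ e₂ : ℝ → ℝ, Tendsto e₁ (𝓝[>] 0) (𝓝 0) ∧ Tendsto e₂ (𝓝[>] 0) (𝓝 0) ∧
      ∀ r : ℝ, 0 < r → r < 1 →
        h r = 1 / r * (c₀ + lam / 4 * r ^ 2 * Real.log r + e₁ r * (r ^ 2 * |Real.log r|)) ∧
        deriv h r = 1 / r ^ 2 * (-c₀ + lam / 4 * r ^ 2 * Real.log r
          + e₂ r * (r ^ 2 * |Real.log r|)) := by
  obtain ⟨ε, H⟩ := hh.isSingularProfile (by rw [alpha_four]; exact one_pos) hc₀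
  rw [alpha_four, c2_four] at H
  have hq₁ := H.tendsto_sub_div_log
  have hq₂ := H.tendsto_rescaledDeriv_div_log
  set q₁ : ℝ → ℝ := fun r => (w 4 h r - c₀) / (r ^ 2 * -Real.log r) with hq₁d
  set q₂ : ℝ → ℝ := fun r => rescaledDeriv 1 (deriv (w 4 h)) r / -Real.log r with hq₂d
  refine ⟨fun r => q₁ r + lam / 4, fun r => q₂ r - q₁ r + lam / 4, ?_, ?_, ?_⟩
  · simpa using hq₁.add_const (lam / 4)
  · have := (hq₂.sub hq₁).add_const (lam / 4)
    have e : -(lam / 2) - -(lam / 4) + lam / 4 = 0 := by ring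
    rwa [e] at this
  · intro r hr hr1
    have hl := Real.log_neg hr hr1
    have hl' : 0 < -Real.log r := neg_pos.2 hl
    have hw₁ : q₁ r * (r ^ 2 * -Real.log r) = w 4 h r - c₀ :=
      div_mul_cancel₀ _ (by positivity)
    have hw₂ : q₂ r * (r ^ 2 * -Real.log r) = r * deriv (w 4 h) r := by
      rw [hq₂d]
      simp only [rescaledDeriv, Real.rpow_one]
      have := hl.ne
      field_simp
    have hm := mul_deriv_w (n := 4) hh.contDiffOn hr
    rw [alpha_four, one_mul, one_add_one_eq_two, Real.rpow_two] at hm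
    have hwr : w 4 h r = r * h r := by rw [w, alpha_four, Real.rpow_one]
    rw [abs_of_neg hl]
    constructor
    · rw [one_div, eq_inv_mul_iff_mul_eq₀ hr.ne', ← hwr]
      linear_combination -hw₁
    · rw [one_div, eq_inv_mul_iff_mul_eq₀ (pow_pos hr 2).ne', hm]
      linear_combination hw₁ - hw₂

end SolitonODE

theorem theorem1p3 (n : ℕ) (hn : n = 2 ∨ n = 3 ∨ n = 4) (lam c₀ c₁ : ℝ)
    (hlam : 0 ≤ lam) (hc₀ : 0 < c₀) (h : ℝ → ℝ)
    (hh : SolitonODE.IsGlobalSingularSolution n lam c₀ c₁ h) :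
    ∃ δ₀ : ℝ, 0 < δ₀ ∧ δ₀ < 1 ∧
      ∃ e₁ e₂ : ℝ → ℝ, Tendsto e₁ (𝓝[>] 0) (𝓝 0) ∧ Tendsto e₂ (𝓝[>] 0) (𝓝 0) ∧
        (n = 2 ∨ n = 3 → ∀ r : ℝ, 0 < r → r ≤ δ₀ →
          h r = 1 / r ^ SolitonODE.alpha n *
            (c₀ - SolitonODE.c2 n / SolitonODE.alpha n * r ^ SolitonODE.alpha n
              - SolitonODE.c2 n * (SolitonODE.c2 n + (n : ℝ) - 1)
                  / (4 * c₀ * SolitonODE.alpha n * (1 - SolitonODE.alpha n))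
                  * r ^ (2 * SolitonODE.alpha n)
              + e₁ r * r ^ (2 * SolitonODE.alpha n)) ∧
          deriv h r = 1 / r ^ (SolitonODE.alpha n + 1) *
            (-SolitonODE.alpha n * c₀
              - SolitonODE.c2 n * (SolitonODE.c2 n + (n : ℝ) - 1)
                  / (4 * c₀ * (1 - SolitonODE.alpha n))
                  * r ^ (2 * SolitonODE.alpha n)
              + e₂ r * r ^ (2 * SolitonODE.alpha n))) ∧
        (n = 4 → ∀ r : ℝ, 0 < r → r ≤ δ₀ →
          h r = 1 / r * (c₀ + lam / 4 * r ^ 2 * Real.log r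
              + e₁ r * (r ^ 2 * |Real.log r|)) ∧
          deriv h r = 1 / r ^ 2 * (-c₀ + lam / 4 * r ^ 2 * Real.log r
              + e₂ r * (r ^ 2 * |Real.log r|))) := by
  rcases or_assoc.2 hn with hn | rfl
  · obtain ⟨e₁, e₂, h₁, h₂, hexp⟩ := hh.expansion_two_three hn hc₀
    refine ⟨1 / 2, by norm_num, by norm_num, e₁, e₂, h₁, h₂, fun _ r hr _ => hexp r hr, ?_⟩
    rintro rfl
    norm_num at hn
  · obtain ⟨e₁, e₂, h₁, h₂, hexp⟩ := hh.expansion_four hc₀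
    -- Any `δ₀ < 1` would do.
    refine ⟨1 / 2, by norm_num, by norm_num, e₁, e₂, h₁, h₂, fun hn => by norm_num at hn,
      fun _ r hr hr2 => hexp r hr (hr2.trans_lt (by norm_num))⟩
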